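/- **Theorem (pmf of the tempered space-fractional Skellam process).** Let $\alpha_1,\alpha_2\in(0,1)$ and $\mu_1,\mu_2,\lambda_1,\lambda_2>0$. Let $N_1,N_2$ be independent homogeneous Poisson processes with intensities $\lambda_1,\lambda_2$. Let $D_{\alpha_1,\mu_1},D_{\alpha_2,\mu_2}$ be independent tempered stable subordinators, that is, non-decreasing Lévy processes with values in $[0,\infty)$ and $\mathbb E[e^{-sD_{\alpha_i,\mu_i}(t)}]=e^{-t((s+\mu_i)^{\alpha_i}-\mu_i^{\alpha_i})}$ for $s>0$, and let $(D_{\alpha_1,\mu_1},D_{\alpha_2,\mu_2})$ be independent of $(N_1,N_2)$. Put $$S(t)=N_1(D_{\alpha_1,\mu_1}(t))-N_2(D_{\alpha_2,\mu_2}(t)),\qquad t\ge 0 .$$ Write $${}_1\psi_1\left[\begin{matrix}(a,A)\\(b,B)\end{matrix};z\right]=\sum_{r=0}^{\infty}\frac{\Gamma(a+Ar)}{\Gamma(b+Br)}\frac{z^r}{r!}$$ for the Fox–Wright function, where $1/\Gamma=0$ at the non-positive integers, and for $i=1,2$ and integers $j\ge 0$ consider the series $$A_i(j)=\sum_{m=0}^{\infty}\frac{\mu_i^m\lambda_i^{-m}}{m!}\;{}_1\psi_1\left[\begin{matrix}(1,\alpha_i)\\(1-j-m,\alpha_i)\end{matrix};-\lambda_i^{\alpha_i}t\right].$$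 Fix $t\ge 0$. 1. The series defining the Fox–Wright functions in $A_1(j),A_2(j)$ converge absolutely. For every $j\ge 2$ and $i\in\{1,2\}$, the series $A_i(j)$ converges if and only if $t=0$ or $\mu_i<\lambda_i$. 2. Suppose that $t=0$, or that $\mu_1<\lambda_1$ and $\mu_2<\lambda_2$. Then the series $A_1(j),A_2(j)$ converge absolutely for all $j\ge0$, and for every integer $k\ge 0$ $$\mathbb P(S(t)=k)=\sum_{n=0}^{\infty}\frac{(-1)^{k}}{n!\,(n+k)!}\,e^{t(\mu_1^{\alpha_1}+\mu_2^{\alpha_2})}\,A_1(n+k)\,A_2(n),$$ while for every integer $k<0$ $$\mathbb P(S(t)=k)=\sum_{n=0}^{\infty}\frac{(-1)^{|k|}}{n!\,(n+|k|)!}\,e^{t(\mu_1^{\alpha_1}+\mu_2^{\alpha_2})}\,A_1(n)\,A_2(n+|k|),$$ where the series over $n$ converge absolutely. -/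

import Mathlib

open MeasureTheory ProbabilityTheory Filter Topology
open scoped NNReal Nat

noncomputable section

/-- A real-valued Lévy process indexed by `[0, ∞)`: it starts at `0`, has independent and
stationary increments, and almost all of its paths are right-continuous with left limits. -/
structure IsLevyProcess {Ω : Type*} [MeasurableSpace Ω]
    (X : ℝ≥0 → Ω → ℝ) (P : Measure Ω) : Prop where
  measurable : ∀ t, Measurable (X t)
  start : ∀ᵐ ω ∂P, X 0 ω = 0
  indep_increments : HasIndepIncrements X P
  stationary : ∀ s t, IdentDistrib (fun ω => X (s + t) ω - X s ω) (X t) P P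
  cadlag : ∀ᵐ ω ∂P, ∀ t : ℝ≥0,
    ContinuousWithinAt (fun s => X s ω) (Set.Ici t) t ∧
      ∃ l : ℝ, Tendsto (fun s => X s ω) (𝓝[<] t) (𝓝 l)

/-- A homogeneous Poisson process of intensity `lam`: a counting process which is a Lévy process
and whose value at time `t` has the Poisson distribution with mean `lam * t`. -/
structure IsPoissonProcess {Ω : Type*} [MeasurableSpace Ω]
    (lam : ℝ) (N : ℝ≥0 → Ω → ℕ) (P : Measure Ω) : Prop where
  levy : IsLevyProcess (fun t ω => (N t ω : ℝ)) P
  law : ∀ t, HasLaw (N t) (poissonMeasure (lam.toNNReal * t)) P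

/-- A tempered `α`-stable subordinator with tempering parameter `μ`: a Lévy process with values
in `[0, ∞)` and almost surely non-decreasing paths, whose Laplace exponent is
`s ↦ (s + μ) ^ α - μ ^ α`. -/
structure IsTemperedStableSubordinator {Ω : Type*} [MeasurableSpace Ω]
    (α μ : ℝ) (D : ℝ≥0 → Ω → ℝ≥0) (P : Measure Ω) : Prop where
  levy : IsLevyProcess (fun t ω => (D t ω : ℝ)) P
  monotone : ∀ᵐ ω ∂P, Monotone (fun t => D t ω)
  laplace : ∀ (t : ℝ≥0) (s : ℝ), 0 < s →
    ∫ ω, Real.exp (-s * (D t ω : ℝ)) ∂P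
      = Real.exp (-(t : ℝ) * ((s + μ) ^ α - μ ^ α))

/-- The tempered space-fractional Skellam process `N₁(D₁(t)) - N₂(D₂(t))`. -/
def tsfsp {Ω : Type*} (N₁ N₂ : ℝ≥0 → Ω → ℕ) (D₁ D₂ : ℝ≥0 → Ω → ℝ≥0)
    (t : ℝ≥0) (ω : Ω) : ℤ :=
  (N₁ (D₁ t ω) ω : ℤ) - (N₂ (D₂ t ω) ω : ℤ)

/-- The `r`-th term `Γ(a + A r) / Γ(b + B r) * z ^ r / r!` of the Fox–Wright series.
`Real.Gamma` vanishes at its poles and `x / 0 = 0`, so that `1 / Γ` has its usual value `0` at the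
non-positive integers. -/
def foxWrightTerm (a A b B z : ℝ) (r : ℕ) : ℝ :=
  Real.Gamma (a + A * r) / Real.Gamma (b + B * r) * (z ^ r / (r ! : ℝ))

/-- The Fox–Wright function `₁ψ₁[(a, A); (b, B); z]`. -/
def foxWright (a A b B z : ℝ) : ℝ :=
  ∑' r : ℕ, foxWrightTerm a A b B z r

/-- The term `μ ^ m * lam ^ (-m) / m! * ₁ψ₁[(1, α); (1 - j - m, α); - lam ^ α * t]`. -/
def innerTerm (α μ lam t : ℝ) (j m : ℕ) : ℝ :=
  μ ^ m * (lam ^ m)⁻¹ / (m ! : ℝ) *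
    foxWright 1 α (1 - (j : ℝ) - (m : ℝ)) α (-lam ^ α * t)

end

/-!
For `f x = exp (-t x ^ α)`, differentiating the exponential series term by term turns the ratio of
Gamma functions into a descending Pochhammer symbol, so that the Fox–Wright value with parameters
`j`, `m` is `λ ^ (j + m) f⁽ʲ⁺ᵐ⁾(λ)`. Hence `A(j)` is `λ ^ j` times the Taylor series of `f⁽ʲ⁾` at
`λ`, evaluated at `λ + μ`. Since `f` is holomorphic on the slit plane, the series converges
absolutely to `λ ^ j f⁽ʲ⁾(λ + μ)` when `μ < λ`. If it converged for some `μ ≥ λ`, the Taylor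
coefficients of `f''` at scale `λ` would be bounded, so `x f''(x)` would be bounded near `0`,
whereas `x f''(x) → ∞`.

Conditionally on the subordinator, `N(D(t))` is Poisson, so its probabilities are
`λ ^ n / n! · 𝔼[T ^ n exp (-λ T)]` with `T = D(t)`, which are derivatives at `λ` of the Laplace
transform `exp (t μ ^ α) f(· + μ)`. The two components being independent, the law of their
difference is the resulting convolution.
-/

theorem gamma_one_add_div_gamma_one_sub_add {x : ℝ} (hx : -1 < x) (n : ℕ) :
    Real.Gamma (1 + x) / Real.Gamma (1 - n + x) = (descPochhammer ℝ n).eval x := by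
  induction n with
  | zero => simp [(Real.Gamma_pos_of_pos (by linarith : 0 < 1 + x)).ne']
  | succ n ih =>
    have shift : 1 - (n : ℝ) + x = (x - n) + 1 := by ring
    rw [descPochhammer_succ_eval, ← ih, shift,
      show 1 - ((n + 1 : ℕ) : ℝ) + x = x - n by push_cast; ring]
    rcases eq_or_ne (x - n) 0 with h | h
    · simp [h]
    · rw [Real.Gamma_add_one h]
      field_simp

theorem abs_descPochhammer_eval_le (n : ℕ) (x : ℝ) :
    |(descPochhammer ℝ n).eval x| ≤ n ! * Real.exp (|x| + n) := by
  calc |(descPochhammer ℝ n).eval x|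
      = ∏ i ∈ Finset.range n, |x - i| := by
        rw [descPochhammer_eval_eq_prod_range, Finset.abs_prod]
    _ ≤ ∏ _i ∈ Finset.range n, (|x| + n) := by
        gcongr with i hi
        have hin : (i : ℝ) ≤ n := by exact_mod_cast (Finset.mem_range.1 hi).le
        exact (abs_sub _ _).trans (by rw [Nat.abs_cast]; gcongr)
    _ = (|x| + n) ^ n := by rw [Finset.prod_const, Finset.card_range]
    _ ≤ n ! * Real.exp (|x| + n) := by
        rw [← div_le_iff₀' (by positivity)]
        exact Real.pow_div_factorial_le_exp _ (by positivity) n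

/-- The stretched exponential `x ↦ exp (-t * x ^ α)`, which is the Laplace transform at time `t` of
the `α`-stable subordinator. -/
noncomputable def stretchedExp (α t x : ℝ) : ℝ := Real.exp (-t * x ^ α)

/-- The `r`-th term of the expansion of `stretchedExp α t x` in powers of `x ^ α`. -/
noncomputable def stretchedExpTerm (α t : ℝ) (r : ℕ) (x : ℝ) : ℝ :=
  (-t) ^ r / (r ! : ℝ) * x ^ (α * r)

theorem hasSum_stretchedExpTerm (α t : ℝ) {x : ℝ} (hx : 0 ≤ x) :
    HasSum (fun r => stretchedExpTerm α t r x) (stretchedExp α t x) := by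
  rw [stretchedExp, Real.exp_eq_exp_ℝ]
  refine (NormedSpace.expSeries_div_hasSum_exp (-t * x ^ α)).congr_fun fun r => ?_
  rw [stretchedExpTerm, Real.rpow_mul_natCast hx, mul_pow]
  ring

theorem iteratedDeriv_stretchedExpTerm (α t : ℝ) (n r : ℕ) (x : ℝ) :
    iteratedDeriv n (stretchedExpTerm α t r) x =
      (-t) ^ r / (r ! : ℝ) * ((descPochhammer ℝ n).eval (α * r) * x ^ (α * r - n)) := by
  unfold stretchedExpTerm
  rw [iteratedDeriv_const_mul_field, iteratedDeriv_eq_iterate, Real.iter_deriv_rpow_const]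

theorem rpow_mul_natCast_sub {x : ℝ} (hx : 0 < x) (α : ℝ) (r n : ℕ) :
    x ^ (α * r - n) = (x ^ α) ^ r / x ^ n := by
  rw [Real.rpow_sub_natCast hx.ne', Real.rpow_mul_natCast hx.le]

theorem summableLocallyUniformlyOn_iteratedDeriv_stretchedExpTerm (α t : ℝ) (n : ℕ) :
    SummableLocallyUniformlyOn (fun r => iteratedDeriv n (stretchedExpTerm α t r))
      (Set.Ioi 0) := by
  refine SummableLocallyUniformlyOn_of_locally_bounded isOpen_Ioi fun K hK hKc => ?_
  obtain ⟨A, hA⟩ := hKc.exists_bound_of_continuousOn (f := fun x : ℝ => x ^ α)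
    (continuousOn_id.rpow_const fun x hx => Or.inl (hK hx).ne')
  obtain ⟨B, hB⟩ := hKc.exists_bound_of_continuousOn (f := fun x : ℝ => (x ^ n)⁻¹)
    ((continuousOn_pow n).inv₀ fun x hx => pow_ne_zero n (hK hx).ne')
  refine ⟨fun r => n ! * Real.exp n * B * ((|t| * Real.exp |α| * A) ^ r / (r ! : ℝ)),
    (Real.summable_pow_div_factorial _).mul_left _, fun r x hx => ?_⟩
  have hpoch := abs_descPochhammer_eval_le n (α * r)
  have hA₀ : 0 ≤ A := (norm_nonneg _).trans (hA x hx)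
  rw [iteratedDeriv_stretchedExpTerm, rpow_mul_natCast_sub (hK hx)]
  calc ‖(-t) ^ r / (r ! : ℝ) * ((descPochhammer ℝ n).eval (α * r) * ((x ^ α) ^ r / x ^ n))‖
      = |t| ^ r / r ! * (|(descPochhammer ℝ n).eval (α * r)| * (‖x ^ α‖ ^ r * ‖(x ^ n)⁻¹‖)) := by
        rw [div_eq_mul_inv ((x ^ α) ^ r)]
        simp only [norm_mul, norm_div, norm_pow, norm_neg, Real.norm_natCast, Real.norm_eq_abs t,
          Real.norm_eq_abs (Polynomial.eval _ _), norm_inv]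
    _ ≤ |t| ^ r / r ! * (n ! * Real.exp (|α * r| + n) * (A ^ r * B)) := by
        gcongr
        exacts [hA x hx, hB x hx]
    _ = n ! * Real.exp n * B * ((|t| * Real.exp |α| * A) ^ r / r !) := by
        rw [Real.exp_add, abs_mul, Nat.abs_cast, mul_comm |α|, Real.exp_nat_mul]
        ring

theorem hasSum_iteratedDeriv_stretchedExpTerm (α t : ℝ) (n : ℕ) {x : ℝ} (hx : 0 < x) :
    HasSum (fun r => iteratedDeriv n (stretchedExpTerm α t r) x)
      (iteratedDeriv n (stretchedExp α t) x) := by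
  have within (k r : ℕ) : Set.EqOn (iteratedDerivWithin k (stretchedExpTerm α t r) (Set.Ioi 0))
      (iteratedDeriv k (stretchedExpTerm α t r)) (Set.Ioi 0) :=
    iteratedDerivWithin_of_isOpen isOpen_Ioi
  have hsummable (k : ℕ) : SummableLocallyUniformlyOn
      (fun r => iteratedDerivWithin k (stretchedExpTerm α t r) (Set.Ioi 0)) (Set.Ioi 0) :=
    SummableLocallyUniformlyOn_congr (fun r _ hy => (within k r hy).symm)
      (summableLocallyUniformlyOn_iteratedDeriv_stretchedExpTerm α t k)
  have hdiff (r k : ℕ) (y : ℝ) (_ : k ≤ n) (hy : y ∈ Set.Ioi 0) :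
      DifferentiableAt ℝ (iteratedDerivWithin k (stretchedExpTerm α t r) (Set.Ioi 0)) y := by
    refine DifferentiableAt.congr_of_eventuallyEq ?_
      ((within k r).eventuallyEq_of_mem (isOpen_Ioi.mem_nhds hy))
    simp only [funext (iteratedDeriv_stretchedExpTerm α t k r)]
    exact ((Real.differentiableAt_rpow_const_of_ne _ (ne_of_gt hy)).const_mul _).const_mul _
  have key := iteratedDerivWithin_tsum n isOpen_Ioi hx
    (fun y hy => (hasSum_stretchedExpTerm α t (le_of_lt hy)).summable)
    (fun k _ _ => hsummable k) hdiff
  have hexp : Set.EqOn (fun y => ∑' r, stretchedExpTerm α t r y) (stretchedExp α t) (Set.Ioi 0) :=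
    fun y hy => (hasSum_stretchedExpTerm α t (le_of_lt hy)).tsum_eq
  rw [iteratedDerivWithin_congr hexp hx, iteratedDerivWithin_of_isOpen isOpen_Ioi hx,
    tsum_congr fun r => within n r hx] at key
  rw [key]
  exact ((summableLocallyUniformlyOn_iteratedDeriv_stretchedExpTerm α t n).summable hx).hasSum

theorem foxWrightTerm_eq_iteratedDeriv {α : ℝ} (hα : 0 ≤ α) (t : ℝ) (n r : ℕ) {x : ℝ}
    (hx : 0 < x) :
    foxWrightTerm 1 α (1 - n) α (-x ^ α * t) r =
      x ^ n * iteratedDeriv n (stretchedExpTerm α t r) x := by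
  have hαr : -1 < α * r := by linarith [mul_nonneg hα r.cast_nonneg]
  rw [foxWrightTerm, gamma_one_add_div_gamma_one_sub_add hαr, iteratedDeriv_stretchedExpTerm,
    rpow_mul_natCast_sub hx, show -x ^ α * t = -t * x ^ α by ring, mul_pow]
  field_simp

theorem hasSum_foxWrightTerm {α : ℝ} (hα : 0 ≤ α) (t : ℝ) (j m : ℕ) {x : ℝ} (hx : 0 < x) :
    HasSum (foxWrightTerm 1 α (1 - (j : ℝ) - (m : ℝ)) α (-x ^ α * t))
      (x ^ (j + m) * iteratedDeriv (j + m) (stretchedExp α t) x) := by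
  rw [sub_sub, ← Nat.cast_add]
  exact ((hasSum_iteratedDeriv_stretchedExpTerm α t (j + m) hx).mul_left _).congr_fun
    fun r => foxWrightTerm_eq_iteratedDeriv hα t (j + m) r hx

theorem innerTerm_eq_iteratedDeriv {α : ℝ} (hα : 0 ≤ α) (μ t : ℝ) (j m : ℕ) {lam : ℝ}
    (hlam : 0 < lam) :
    innerTerm α μ lam t j m =
      lam ^ j * (μ ^ m / (m ! : ℝ) * iteratedDeriv (j + m) (stretchedExp α t) lam) := by
  rw [innerTerm, foxWright, (hasSum_foxWrightTerm hα t j m hlam).tsum_eq, pow_add]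
  field_simp

section HolomorphicExtension

variable {f : ℝ → ℝ} {F : ℂ → ℂ} {U : Set ℂ}

theorem deriv_ofReal_eq_of_eq_ofReal (hU : IsOpen U) (hF : DifferentiableOn ℂ F U)
    (hfF : ∀ x : ℝ, (x : ℂ) ∈ U → F x = f x) {x : ℝ} (hx : (x : ℂ) ∈ U) :
    deriv F x = deriv f x := by
  have hFx : HasDerivAt F (deriv F x) x := (hF.differentiableAt (hU.mem_nhds hx)).hasDerivAt
  have hev : (fun y : ℝ => F y) =ᶠ[𝓝 x] fun y => (f y : ℂ) := by
    filter_upwards [Complex.continuous_ofReal.continuousAt.preimage_mem_nhds (hU.mem_nhds hx)]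
      with y hy using hfF y hy
  have hf : HasDerivAt f (deriv F x).re x :=
    hFx.real_of_complex.congr_of_eventuallyEq (hev.mono fun y hy => by
      simp only [hy, Complex.ofReal_re])
  rw [hf.deriv]
  exact (hFx.comp_ofReal.congr_of_eventuallyEq hev.symm).unique hf.ofReal_comp

theorem iteratedDeriv_ofReal_eq_of_eq_ofReal (hU : IsOpen U) (hF : DifferentiableOn ℂ F U)
    (hfF : ∀ x : ℝ, (x : ℂ) ∈ U → F x = f x) (n : ℕ) {x : ℝ} (hx : (x : ℂ) ∈ U) :
    iteratedDeriv n F x = iteratedDeriv n f x := by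
  induction n generalizing f F with
  | zero => simpa only [iteratedDeriv_zero] using hfF x hx
  | succ n ih =>
    rw [iteratedDeriv_succ', iteratedDeriv_succ']
    exact ih (hF.deriv hU) fun y hy => deriv_ofReal_eq_of_eq_ofReal hU hF hfF hy

theorem hasSum_taylorSeries_of_eq_ofReal {x R : ℝ}
    (hF : DifferentiableOn ℂ F (Metric.ball (x : ℂ) R))
    (hfF : ∀ y : ℝ, (y : ℂ) ∈ Metric.ball (x : ℂ) R → F y = f y) {h : ℝ} (hh : |h| < R) :
    HasSum (fun m : ℕ => h ^ m / (m ! : ℝ) * iteratedDeriv m f x) (f (x + h)) := by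
  have hmem : ((x + h : ℝ) : ℂ) ∈ Metric.ball (x : ℂ) R := by
    rwa [mem_ball_iff_norm, ← Complex.ofReal_sub, Complex.norm_real, add_sub_cancel_left]
  have hx : (x : ℂ) ∈ Metric.ball (x : ℂ) R := Metric.mem_ball_self ((abs_nonneg h).trans_lt hh)
  have htaylor := Complex.hasSum_taylorSeries_on_ball hF hmem
  rw [hfF _ hmem] at htaylor
  rw [← Complex.hasSum_ofReal]
  refine htaylor.congr_fun fun m => ?_
  rw [iteratedDeriv_ofReal_eq_of_eq_ofReal Metric.isOpen_ball hF hfF m hx]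
  push_cast
  simp only [smul_eq_mul, add_sub_cancel_left]
  ring

end HolomorphicExtension

/-- The holomorphic extension of `stretchedExp α t` to the slit plane. -/
noncomputable def complexStretchedExp (α t : ℝ) (z : ℂ) : ℂ := Complex.exp (-t * z ^ (α : ℂ))

theorem differentiableOn_complexStretchedExp (α t : ℝ) :
    DifferentiableOn ℂ (complexStretchedExp α t) Complex.slitPlane := fun _ hz =>
  ((differentiableAt_id.cpow_const hz).const_mul _).cexp.differentiableWithinAt

theorem complexStretchedExp_ofReal (α t : ℝ) {x : ℝ} (hx : 0 ≤ x) :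
    complexStretchedExp α t x = stretchedExp α t x := by
  simp [complexStretchedExp, stretchedExp, Complex.ofReal_cpow hx]

theorem ball_ofReal_self_subset_slitPlane (x : ℝ) :
    Metric.ball (x : ℂ) x ⊆ Complex.slitPlane := fun z hz => by
  have hre := (Complex.abs_re_le_norm (z - x)).trans_lt (mem_ball_iff_norm.1 hz)
  rw [Complex.sub_re, Complex.ofReal_re] at hre
  exact Or.inl (by linarith [neg_abs_le (z.re - x)])

theorem hasSum_taylorSeries_iteratedDeriv_stretchedExp (α t : ℝ) (j : ℕ) {x h : ℝ}
    (hh : |h| < x) :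
    HasSum (fun m : ℕ => h ^ m / (m ! : ℝ) * iteratedDeriv (j + m) (stretchedExp α t) x)
      (iteratedDeriv j (stretchedExp α t) (x + h)) := by
  have hdiff : DifferentiableOn ℂ (iteratedDeriv j (complexStretchedExp α t))
      Complex.slitPlane := by
    induction j with
    | zero => simpa only [iteratedDeriv_zero] using differentiableOn_complexStretchedExp α t
    | succ j ih => simpa only [iteratedDeriv_succ] using ih.deriv Complex.isOpen_slitPlane
  have hreal (y : ℝ) (hy : (y : ℂ) ∈ Complex.slitPlane) :
      iteratedDeriv j (complexStretchedExp α t) y = iteratedDeriv j (stretchedExp α t) y :=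
    iteratedDeriv_ofReal_eq_of_eq_ofReal Complex.isOpen_slitPlane
      (differentiableOn_complexStretchedExp α t)
      (fun _ hz => complexStretchedExp_ofReal α t (Complex.ofReal_mem_slitPlane.1 hz).le) j hy
  have hball := ball_ofReal_self_subset_slitPlane x
  simpa only [iteratedDeriv_eq_iterate, ← Function.iterate_add_apply, add_comm j] using
    hasSum_taylorSeries_of_eq_ofReal (hdiff.mono hball) (fun y hy => hreal y (hball hy)) hh

theorem hasSum_innerTerm {α μ t lam : ℝ} (hα : 0 ≤ α) (hμ : 0 ≤ μ) (hlam : 0 < lam)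
    (h : t = 0 ∨ μ < lam) (j : ℕ) :
    HasSum (innerTerm α μ lam t j)
      (lam ^ j * iteratedDeriv j (stretchedExp α t) (lam + μ)) := by
  simp only [funext fun m => innerTerm_eq_iteratedDeriv hα μ t j m hlam]
  refine HasSum.mul_left _ ?_
  rcases h with rfl | h
  · have hone : stretchedExp α 0 = fun _ => 1 := by ext; simp [stretchedExp]
    have hsum := hasSum_single (f := fun m : ℕ => μ ^ m / (m ! : ℝ) *
      iteratedDeriv (j + m) (stretchedExp α 0) lam) 0 fun m hm => by
        simp [hone, iteratedDeriv_const, hm]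
    simpa [hone, iteratedDeriv_const] using hsum
  · exact hasSum_taylorSeries_iteratedDeriv_stretchedExp α t j (by rwa [abs_of_nonneg hμ])

theorem hasDerivAt_stretchedExp (α t : ℝ) {x : ℝ} (hx : 0 < x) :
    HasDerivAt (stretchedExp α t) (stretchedExp α t x * (-t * (α * x ^ (α - 1)))) x :=
  ((Real.hasDerivAt_rpow_const (Or.inl hx.ne')).const_mul (-t)).exp

theorem iteratedDeriv_two_stretchedExp (α t : ℝ) {x : ℝ} (hx : 0 < x) :
    iteratedDeriv 2 (stretchedExp α t) x =
      ((t * α * x ^ (α - 1)) ^ 2 + t * α * (1 - α) * x ^ (α - 2)) * stretchedExp α t x := by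
  have hderiv : deriv (stretchedExp α t) =ᶠ[𝓝 x]
      stretchedExp α t * fun y => -t * (α * y ^ (α - 1)) := by
    filter_upwards [lt_mem_nhds hx] with y hy using (hasDerivAt_stretchedExp α t hy).deriv
  have hpow := ((Real.hasDerivAt_rpow_const (p := α - 1) (Or.inl hx.ne')).const_mul α).const_mul
    (-t)
  rw [iteratedDeriv_succ, iteratedDeriv_one, hderiv.deriv_eq,
    ((hasDerivAt_stretchedExp α t hx).mul hpow).deriv, show α - 2 = α - 1 - 1 by ring]
  ring

theorem le_mul_iteratedDeriv_two_stretchedExp {α t x : ℝ} (hα₀ : 0 ≤ α) (hα₁ : α ≤ 1)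
    (ht : 0 ≤ t) (hx₀ : 0 < x) (hx₁ : x ≤ 1) :
    t * α * (1 - α) * Real.exp (-t) * x ^ (α - 1) ≤
      x * iteratedDeriv 2 (stretchedExp α t) x := by
  have hexp : Real.exp (-t) ≤ stretchedExp α t x :=
    Real.exp_le_exp.2 (by nlinarith [Real.rpow_le_one hx₀.le hx₁ hα₀])
  have hpow : x ^ (α - 1) = x * x ^ (α - 2) := by
    rw [show α - 1 = 1 + (α - 2) by ring, Real.rpow_add hx₀, Real.rpow_one]
  have : 0 ≤ 1 - α := sub_nonneg.2 hα₁
  calc t * α * (1 - α) * Real.exp (-t) * x ^ (α - 1)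
      = x * ((0 + t * α * (1 - α) * x ^ (α - 2)) * Real.exp (-t)) := by rw [hpow]; ring
    _ ≤ x * (((t * α * x ^ (α - 1)) ^ 2 + t * α * (1 - α) * x ^ (α - 2)) *
          stretchedExp α t x) := by gcongr; positivity
    _ = x * iteratedDeriv 2 (stretchedExp α t) x := by rw [iteratedDeriv_two_stretchedExp α t hx₀]

theorem tendsto_mul_iteratedDeriv_two_stretchedExp {α t : ℝ} (hα₀ : 0 < α) (hα₁ : α < 1)
    (ht : 0 < t) :
    Tendsto (fun x => x * iteratedDeriv 2 (stretchedExp α t) x) (𝓝[>] 0) atTop := by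
  have : 0 < 1 - α := sub_pos.2 hα₁
  have hlim : Tendsto (fun x : ℝ => t * α * (1 - α) * Real.exp (-t) * x ^ (α - 1)) (𝓝[>] 0)
      atTop :=
    (tendsto_rpow_neg_nhdsGT_zero (by linarith)).const_mul_atTop (by positivity)
  refine tendsto_atTop_mono' _ ?_ hlim
  filter_upwards [Ioc_mem_nhdsGT one_pos] with x hx
  exact le_mul_iteratedDeriv_two_stretchedExp hα₀.le hα₁.le ht.le hx.1 hx.2

theorem le_mul_inv_one_sub_of_hasSum {c : ℕ → ℝ} {C ρ v : ℝ} (hc : ∀ n, |c n| ≤ C)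
    (hρ₀ : 0 ≤ ρ) (hρ₁ : ρ < 1) (hv : HasSum (fun n => (-ρ) ^ n * c n) v) :
    v ≤ C * (1 - ρ)⁻¹ := by
  refine hasSum_le (fun n => ?_) hv ((hasSum_geometric_of_lt_one hρ₀ hρ₁).mul_left C)
  calc (-ρ) ^ n * c n ≤ |(-ρ) ^ n * c n| := le_abs_self _
    _ = |c n| * ρ ^ n := by rw [abs_mul, abs_pow, abs_neg, abs_of_nonneg hρ₀, mul_comm]
    _ ≤ C * ρ ^ n := by gcongr; exact hc n

theorem mul_iteratedDeriv_two_stretchedExp_le {α t lam C : ℝ}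
    (hC : ∀ p : ℕ, |lam ^ p / (p ! : ℝ) * iteratedDeriv (2 + p) (stretchedExp α t) lam| ≤ C)
    {x : ℝ} (hx₀ : 0 < x) (hxlam : x ≤ lam) :
    x * iteratedDeriv 2 (stretchedExp α t) x ≤ C * lam := by
  have hlam : 0 < lam := hx₀.trans_le hxlam
  have htaylor := hasSum_taylorSeries_iteratedDeriv_stretchedExp α t 2 (x := lam) (h := x - lam)
    (by rw [abs_lt]; constructor <;> linarith)
  rw [add_sub_cancel] at htaylor
  have hbound := le_mul_inv_one_sub_of_hasSum hC (ρ := 1 - x / lam)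
    (sub_nonneg.2 ((div_le_one hlam).2 hxlam)) (by linarith [div_pos hx₀ hlam])
    (htaylor.congr_fun fun p => by
      rw [show x - lam = -(1 - x / lam) * lam by field_simp; ring, mul_pow]
      ring)
  rw [sub_sub_cancel, inv_div] at hbound
  calc x * iteratedDeriv 2 (stretchedExp α t) x ≤ x * (C * (lam / x)) := by gcongr
    _ = C * lam := by field_simp

theorem abs_taylor_coeff_le_abs_innerTerm {α μ lam : ℝ} (hα : 0 ≤ α) (t : ℝ) (i m : ℕ)
    (hlam : 0 < lam) (hle : lam ≤ μ) :
    |lam ^ (i + m) / ((i + m)! : ℝ) * iteratedDeriv (2 + (i + m)) (stretchedExp α t) lam| ≤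
      |innerTerm α μ lam t (i + 2) m| / lam ^ 2 := by
  have hμ : 0 < μ := hlam.trans_le hle
  have hfac : (m ! : ℝ) ≤ ((i + m)! : ℝ) := by
    exact_mod_cast Nat.factorial_le (Nat.le_add_left m i)
  rw [innerTerm_eq_iteratedDeriv hα μ t _ m hlam, show i + 2 + m = 2 + (i + m) by ring]
  set d := iteratedDeriv (2 + (i + m)) (stretchedExp α t) lam
  calc |lam ^ (i + m) / ((i + m)! : ℝ) * d| = lam ^ i * lam ^ m / ((i + m)! : ℝ) * |d| := by
        rw [abs_mul, abs_of_nonneg (by positivity), pow_add]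
    _ ≤ lam ^ i * μ ^ m / (m ! : ℝ) * |d| := by gcongr
    _ = |lam ^ (i + 2) * (μ ^ m / (m ! : ℝ) * d)| / lam ^ 2 := by
        rw [abs_mul, abs_mul, abs_of_pos (by positivity : 0 < lam ^ (i + 2)),
          abs_of_pos (by positivity : 0 < μ ^ m / (m ! : ℝ))]
        field_simp
        ring

theorem not_tendsto_innerTerm_zero {α μ t lam : ℝ} (hα₀ : 0 < α) (hα₁ : α < 1) (hlam : 0 < lam)
    (ht : 0 < t) (hle : lam ≤ μ) {j : ℕ} (hj : 2 ≤ j) :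
    ¬ Tendsto (innerTerm α μ lam t j) atTop (𝓝 0) := by
  intro hzero
  obtain ⟨i, rfl⟩ := Nat.exists_eq_add_of_le' hj
  obtain ⟨B, hB⟩ := Asymptotics.isBigO_one_nat_atTop_iff.1 (hzero.isBigO_one ℝ)
  have hbig : (fun p : ℕ => lam ^ p / (p ! : ℝ) * iteratedDeriv (2 + p) (stretchedExp α t) lam)
      =O[atTop] (fun _ => (1 : ℝ)) := by
    refine Asymptotics.IsBigO.of_bound (B / lam ^ 2) ?_
    filter_upwards [eventually_ge_atTop i] with p hp
    obtain ⟨m, rfl⟩ := Nat.exists_eq_add_of_le hp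
    rw [norm_one, mul_one]
    refine (abs_taylor_coeff_le_abs_innerTerm hα₀.le t i m hlam hle).trans ?_
    gcongr
    exact hB m
  obtain ⟨C, hC⟩ := Asymptotics.isBigO_one_nat_atTop_iff.1 hbig
  obtain ⟨x, hlarge, hx⟩ := (((tendsto_mul_iteratedDeriv_two_stretchedExp hα₀ hα₁
    ht).eventually_gt_atTop (C * lam)).and (Ioc_mem_nhdsGT hlam)).exists
  exact hlarge.not_ge (mul_iteratedDeriv_two_stretchedExp_le hC hx.1 hx.2)

theorem exists_tendsto_sum_innerTerm_iff {α μ t lam : ℝ} (hα₀ : 0 < α) (hα₁ : α < 1)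
    (hμ : 0 ≤ μ) (hlam : 0 < lam) (ht : 0 ≤ t) {j : ℕ} (hj : 2 ≤ j) :
    (∃ s, Tendsto (fun M => ∑ m ∈ Finset.range M, innerTerm α μ lam t j m) atTop (𝓝 s)) ↔
      t = 0 ∨ μ < lam := by
  refine ⟨fun ⟨s, hs⟩ => ?_, fun h =>
    ⟨_, (hasSum_innerTerm hα₀.le hμ hlam h j).tendsto_sum_nat⟩⟩
  by_contra! hcon
  refine not_tendsto_innerTerm_zero hα₀ hα₁ hlam (ht.lt_of_ne' hcon.1) hcon.2 hj ?_
  simpa [Finset.sum_range_succ] using ((tendsto_add_atTop_iff_nat 1).2 hs).sub hs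

section GridRight

/-- The first point of the grid `{(i + 1) / (n + 1) | i : ℕ}` strictly to the right of `s`. -/
noncomputable def gridRight (n : ℕ) (s : ℝ≥0) : ℝ≥0 := (⌊(n + 1) * s⌋₊ + 1) / (n + 1)

theorem lt_gridRight (n : ℕ) (s : ℝ≥0) : s < gridRight n s := by
  rw [gridRight, lt_div_iff₀ (by positivity), mul_comm]
  exact Nat.lt_floor_add_one _

theorem gridRight_le (n : ℕ) (s : ℝ≥0) : gridRight n s ≤ s + 1 / ((n : ℝ≥0) + 1) := by
  rw [gridRight, add_div]
  gcongr
  rw [div_le_iff₀ (by positivity), mul_comm s]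
  exact Nat.floor_le zero_le

theorem tendsto_gridRight (s : ℝ≥0) : Tendsto (fun n => gridRight n s) atTop (𝓝[>] s) := by
  refine tendsto_nhdsWithin_iff.2 ⟨?_, .of_forall fun n => lt_gridRight n s⟩
  refine tendsto_of_tendsto_of_tendsto_of_le_of_le tendsto_const_nhds ?_
    (fun n => (lt_gridRight n s).le) fun n => gridRight_le n s
  simpa using (tendsto_one_div_add_atTop_nhds_zero_nat (𝕜 := ℝ≥0)).const_add s

theorem measurable_eval_gridRight {E : Type*} [MeasurableSpace E] (n : ℕ) :
    Measurable fun p : (ℝ≥0 → E) × ℝ≥0 => p.1 (gridRight n p.2) := by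
  have hfloor : Measurable fun s : ℝ≥0 => ⌊((n : ℝ≥0) + 1) * s⌋₊ :=
    Nat.measurable_floor.comp (measurable_id.const_mul _)
  have heval : Measurable fun q : (ℝ≥0 → E) × ℕ => q.1 (((q.2 : ℝ≥0) + 1) / (n + 1)) :=
    measurable_from_prod_countable_left fun i => measurable_pi_apply (((i : ℝ≥0) + 1) / (n + 1))
  exact heval.comp (measurable_fst.prodMk (hfloor.comp measurable_snd))

end GridRight

theorem indepFun_prodMk_prodMk {Ω : Type*} [MeasurableSpace Ω] {P : Measure Ω}
    [IsProbabilityMeasure P] {α β γ δ : Type*} [MeasurableSpace α]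
    [MeasurableSpace β] [MeasurableSpace γ] [MeasurableSpace δ] {X : Ω → α} {Y : Ω → β}
    {S : Ω → γ} {T : Ω → δ} (hX : Measurable X) (hY : Measurable Y) (hS : Measurable S)
    (hT : Measurable T) (hXY : IndepFun X Y P) (hST : IndepFun S T P)
    (h : IndepFun (fun ω => (X ω, Y ω)) (fun ω => (S ω, T ω)) P) :
    IndepFun (fun ω => (X ω, S ω)) (fun ω => (Y ω, T ω)) P := by
  refine IndepSets.indep (hX.prodMk hS).comap_le (hY.prodMk hT).comap_le
    (isPiSystem_prod.comap _) (isPiSystem_prod.comap _)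
    (by rw [← generateFrom_prod, MeasurableSpace.comap_generateFrom]; rfl)
    (by rw [← generateFrom_prod, MeasurableSpace.comap_generateFrom]; rfl) ?_
  rw [IndepSets_iff]
  rintro _ _ ⟨_, ⟨A, hA, C, hC, rfl⟩, rfl⟩ ⟨_, ⟨B, hB, D, hD, rfl⟩, rfl⟩
  have hXS := (h.comp measurable_fst measurable_fst).measure_inter_preimage_eq_mul A C hA hC
  have hYT := (h.comp measurable_snd measurable_snd).measure_inter_preimage_eq_mul B D hB hD
  have hjoint := h.measure_inter_preimage_eq_mul (A ×ˢ B) (C ×ˢ D) (hA.prod hB) (hC.prod hD)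
  calc P (_ ∩ _) = P (X ⁻¹' A ∩ Y ⁻¹' B ∩ (S ⁻¹' C ∩ T ⁻¹' D)) := by
        congr 1; ext ω; simp only [Set.mem_inter_iff, Set.mem_preimage, Set.mem_prod]; tauto
    _ = P (X ⁻¹' A ∩ Y ⁻¹' B) * P (S ⁻¹' C ∩ T ⁻¹' D) := hjoint
    _ = P (X ⁻¹' A ∩ S ⁻¹' C) * P (Y ⁻¹' B ∩ T ⁻¹' D) := by
        rw [hXY.measure_inter_preimage_eq_mul A B hA hB,
          hST.measure_inter_preimage_eq_mul C D hC hD]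
        exact (mul_mul_mul_comm _ _ _ _).trans (congrArg₂ _ hXS.symm hYT.symm)

section RandomTime

variable {E : Type*} [TopologicalSpace E] [Nonempty E]

/-- The limit of `y` at `s` along the grid points to the right of `s`. It equals `y s` for
right-continuous `y` and, unlike evaluation, it is jointly measurable in `y` and `s`. -/
noncomputable def rightEval (y : ℝ≥0 → E) (s : ℝ≥0) : E :=
  limUnder atTop fun n => y (gridRight n s)

theorem rightEval_eq [T2Space E] {y : ℝ≥0 → E} {s : ℝ≥0}
    (hy : ContinuousWithinAt y (Set.Ici s) s) : rightEval y s = y s :=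
  ((hy.mono Set.Ioi_subset_Ici_self).tendsto.comp (tendsto_gridRight s)).limUnder_eq

variable {Ω : Type*} [MeasurableSpace Ω] {P : Measure Ω} {Y : Ω → ℝ≥0 → E} {T : Ω → ℝ≥0}

theorem rightEval_ae_eq [T2Space E]
    (hY : ∀ᵐ ω ∂P, ∀ s, ContinuousWithinAt (Y ω) (Set.Ici s) s) (T : Ω → ℝ≥0) :
    (fun ω => rightEval (Y ω) (T ω)) =ᵐ[P] fun ω => Y ω (T ω) := by
  filter_upwards [hY] with ω hω using rightEval_eq (hω (T ω))

variable [PolishSpace E] [MeasurableSpace E] [BorelSpace E]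

theorem measurable_rightEval :
    Measurable fun p : (ℝ≥0 → E) × ℝ≥0 => rightEval p.1 p.2 := by
  let := TopologicalSpace.upgradeIsCompletelyMetrizable E
  exact (StronglyMeasurable.limUnder fun n =>
    (measurable_eval_gridRight n).stronglyMeasurable).measurable

theorem aemeasurable_eval_randomTime (hYm : Measurable Y) (hTm : Measurable T)
    (hY : ∀ᵐ ω ∂P, ∀ s, ContinuousWithinAt (Y ω) (Set.Ici s) s) :
    AEMeasurable (fun ω => Y ω (T ω)) P :=
  ⟨_, measurable_rightEval.comp (hYm.prodMk hTm), (rightEval_ae_eq hY T).symm⟩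

theorem indepFun_eval_randomTime {Y₁ Y₂ : Ω → ℝ≥0 → E} {T₁ T₂ : Ω → ℝ≥0}
    (hY₁ : ∀ᵐ ω ∂P, ∀ s, ContinuousWithinAt (Y₁ ω) (Set.Ici s) s)
    (hY₂ : ∀ᵐ ω ∂P, ∀ s, ContinuousWithinAt (Y₂ ω) (Set.Ici s) s)
    (h : IndepFun (fun ω => (Y₁ ω, T₁ ω)) (fun ω => (Y₂ ω, T₂ ω)) P) :
    IndepFun (fun ω => Y₁ ω (T₁ ω)) (fun ω => Y₂ ω (T₂ ω)) P :=
  (h.comp measurable_rightEval measurable_rightEval).congr (rightEval_ae_eq hY₁ T₁)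
    (rightEval_ae_eq hY₂ T₂)

theorem measure_eval_randomTime_mem [IsProbabilityMeasure P] (hYm : Measurable Y)
    (hTm : Measurable T) (hY : ∀ᵐ ω ∂P, ∀ s, ContinuousWithinAt (Y ω) (Set.Ici s) s)
    (h : IndepFun Y T P) {A : Set E} (hA : MeasurableSet A) :
    P {ω | Y ω (T ω) ∈ A} = ∫⁻ s, P {ω | Y ω s ∈ A} ∂(P.map T) := by
  have hmem : MeasurableSet {p : (ℝ≥0 → E) × ℝ≥0 | rightEval p.1 p.2 ∈ A} :=
    measurable_rightEval hA
  have hsets (S : Ω → ℝ≥0) : P {ω | Y ω (S ω) ∈ A} = P {ω | rightEval (Y ω) (S ω) ∈ A} :=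
    measure_congr ((rightEval_ae_eq hY S).symm.preimage A)
  have := Measure.isProbabilityMeasure_map (μ := P) hYm.aemeasurable
  have := Measure.isProbabilityMeasure_map (μ := P) hTm.aemeasurable
  calc P {ω | Y ω (T ω) ∈ A}
      = P.map (fun ω => (Y ω, T ω)) {p | rightEval p.1 p.2 ∈ A} := by
        rw [hsets, Measure.map_apply (hYm.prodMk hTm) hmem]; rfl
    _ = ∫⁻ s, P.map Y {y | rightEval y s ∈ A} ∂(P.map T) := by
        rw [(indepFun_iff_map_prod_eq_prod_map_map hYm.aemeasurable hTm.aemeasurable).1 h,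
          Measure.prod_apply_symm hmem]
        rfl
    _ = ∫⁻ s, P {ω | Y ω s ∈ A} ∂(P.map T) := lintegral_congr fun s => by
        rw [hsets fun _ => s]
        exact Measure.map_apply hYm (measurable_prodMk_right hmem)

end RandomTime

section MixedPoisson

variable {Ω : Type*} [MeasurableSpace Ω] {P : Measure Ω}

/-- A counting process with almost surely right-continuous paths whose value at time `t` is Poisson
distributed with mean `lam * t`. In contrast to a Poisson process, nothing is required of the
joint law of its increments. -/
structure HasPoissonMarginals (lam : ℝ) (N : ℝ≥0 → Ω → ℕ) (P : Measure Ω) : Prop where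
  measurable : ∀ t, Measurable (N t)
  law : ∀ t, HasLaw (N t) (poissonMeasure (lam.toNNReal * t)) P
  rightContinuous : ∀ᵐ ω ∂P, ∀ s, ContinuousWithinAt (fun t => N t ω) (Set.Ici s) s

theorem IsPoissonProcess.hasPoissonMarginals {lam : ℝ} {N : ℝ≥0 → Ω → ℕ}
    (hN : IsPoissonProcess lam N P) : HasPoissonMarginals lam N P where
  measurable t :=
    Nat.isClosedEmbedding_coe_real.measurableEmbedding.measurable_comp_iff.1 (hN.levy.measurable t)
  law := hN.law
  rightContinuous := hN.levy.cadlag.mono fun _ hω s =>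
    Nat.isClosedEmbedding_coe_real.isEmbedding.tendsto_nhds_iff.2 (hω s).1

theorem HasPoissonMarginals.aemeasurable_randomTime {lam : ℝ} {N : ℝ≥0 → Ω → ℕ}
    (hN : HasPoissonMarginals lam N P) {T : Ω → ℝ≥0} (hT : Measurable T) :
    AEMeasurable (fun ω => N (T ω) ω) P :=
  aemeasurable_eval_randomTime (measurable_pi_lambda _ hN.measurable) hT hN.rightContinuous

theorem HasPoissonMarginals.indepFun_randomTime [IsProbabilityMeasure P] {lam₁ lam₂ : ℝ}
    {N₁ N₂ : ℝ≥0 → Ω → ℕ} (hN₁ : HasPoissonMarginals lam₁ N₁ P)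
    (hN₂ : HasPoissonMarginals lam₂ N₂ P) {T₁ T₂ : Ω → ℝ≥0} (hT₁ : Measurable T₁)
    (hT₂ : Measurable T₂) (hN : IndepFun (fun ω t => N₁ t ω) (fun ω t => N₂ t ω) P)
    (hT : IndepFun T₁ T₂ P)
    (hNT : IndepFun (fun ω => ((fun t => N₁ t ω), (fun t => N₂ t ω)))
      (fun ω => (T₁ ω, T₂ ω)) P) :
    IndepFun (fun ω => N₁ (T₁ ω) ω) (fun ω => N₂ (T₂ ω) ω) P :=
  indepFun_eval_randomTime hN₁.rightContinuous hN₂.rightContinuous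
    (indepFun_prodMk_prodMk (measurable_pi_lambda _ hN₁.measurable)
      (measurable_pi_lambda _ hN₂.measurable) hT₁ hT₂ hN hT hNT)

/-- The random variable `T ≥ 0` has the law at time `t` of the tempered `α`-stable subordinator with
tempering parameter `μ`. -/
structure HasTemperedStableLaw (α μ t : ℝ) (T : Ω → ℝ≥0) (P : Measure Ω) : Prop where
  measurable : Measurable T
  laplace : ∀ s : ℝ, 0 < s →
    ∫ ω, Real.exp (-s * (T ω : ℝ)) ∂P = Real.exp (-t * ((s + μ) ^ α - μ ^ α))

theorem IsTemperedStableSubordinator.hasTemperedStableLaw {α μ : ℝ} {D : ℝ≥0 → Ω → ℝ≥0}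
    (hD : IsTemperedStableSubordinator α μ D P) (t : ℝ≥0) :
    HasTemperedStableLaw α μ t (D t) P where
  measurable := measurable_coe_nnreal_real_iff.1 (hD.levy.measurable t)
  laplace := hD.laplace t

theorem Iio_zero_subset_integrableExpSet [IsFiniteMeasure P] {T : Ω → ℝ≥0} (hT : Measurable T) :
    Set.Iio 0 ⊆ integrableExpSet (fun ω => (T ω : ℝ)) P := fun v hv => by
  refine Integrable.of_bound (C := 1)
    (hT.coe_nnreal_real.const_mul v).exp.aestronglyMeasurable (ae_of_all _ fun ω => ?_)
  rw [Real.norm_of_nonneg (Real.exp_pos _).le]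
  exact Real.exp_le_one_iff.2 (mul_nonpos_of_nonpos_of_nonneg (le_of_lt hv) (T ω).2)

theorem HasTemperedStableLaw.integral_pow_mul_exp_neg [IsFiniteMeasure P] {α μ t : ℝ}
    {T : Ω → ℝ≥0} (hT : HasTemperedStableLaw α μ t T P) {lam : ℝ} (hlam : 0 < lam) (n : ℕ) :
    ∫ ω, (T ω : ℝ) ^ n * Real.exp (-lam * T ω) ∂P =
      (-1) ^ n * Real.exp (t * μ ^ α) * iteratedDeriv n (stretchedExp α t) (lam + μ) := by
  have hint : -lam ∈ interior (integrableExpSet (fun ω => (T ω : ℝ)) P) :=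
    interior_maximal (Iio_zero_subset_integrableExpSet hT.measurable) isOpen_Iio
      (neg_lt_zero.2 hlam)
  have hmgf : mgf (fun ω => (T ω : ℝ)) P =ᶠ[𝓝 (-lam)]
      fun v => Real.exp (t * μ ^ α) * stretchedExp α t (μ - v) := by
    filter_upwards [gt_mem_nhds (neg_lt_zero.2 hlam)] with v hv
    have hlaplace := hT.laplace (-v) (neg_pos.2 hv)
    rw [neg_neg, neg_add_eq_sub] at hlaplace
    rw [mgf, hlaplace, stretchedExp, ← Real.exp_add]
    congr 1
    ring
  have hmoment := iteratedDeriv_mgf hint n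
  rw [hmgf.iteratedDeriv_eq, iteratedDeriv_const_mul_field, iteratedDeriv_comp_const_sub] at hmoment
  rw [← hmoment]
  simp only [sub_neg_eq_add, add_comm μ, smul_eq_mul]
  ring

theorem HasPoissonMarginals.measureReal_randomTime_eq [IsProbabilityMeasure P] {lam : ℝ}
    {N : ℝ≥0 → Ω → ℕ} {T : Ω → ℝ≥0} (hN : HasPoissonMarginals lam N P) (hlam : 0 ≤ lam)
    (hT : Measurable T) (h : IndepFun (fun ω t => N t ω) T P) (n : ℕ) :
    P.real {ω | N (T ω) ω = n} =
      lam ^ n / (n ! : ℝ) * ∫ ω, (T ω : ℝ) ^ n * Real.exp (-lam * T ω) ∂P := by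
  have hpoisson (s : ℝ≥0) : P {ω | N s ω ∈ ({n} : Set ℕ)} =
      ENNReal.ofReal (lam ^ n / (n ! : ℝ) * ((s : ℝ) ^ n * Real.exp (-lam * s))) := by
    rw [(hN.law s).measure_eq (p := (· ∈ ({n} : Set ℕ))) (measurableSet_singleton n)]
    refine (poissonMeasure_singleton _ n).trans (congrArg ENNReal.ofReal ?_)
    rw [NNReal.coe_mul, Real.coe_toNNReal _ hlam, mul_pow, neg_mul]
    ring
  have hmix := measure_eval_randomTime_mem (measurable_pi_lambda _ hN.measurable) hT
    hN.rightContinuous h (measurableSet_singleton n)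
  rw [lintegral_congr hpoisson, lintegral_map (by fun_prop) hT] at hmix
  rw [← integral_const_mul, integral_eq_lintegral_of_nonneg_ae
    (ae_of_all _ fun ω => by positivity) (by fun_prop), ← hmix]
  rfl

theorem measureReal_randomTime_eq_tsum_innerTerm [IsProbabilityMeasure P] {α μ t lam : ℝ}
    {N : ℝ≥0 → Ω → ℕ} {T : Ω → ℝ≥0} (hα : 0 ≤ α) (hμ : 0 ≤ μ) (hlam : 0 < lam)
    (hN : HasPoissonMarginals lam N P) (hT : HasTemperedStableLaw α μ t T P)
    (hNT : IndepFun (fun ω t => N t ω) T P) (h : t = 0 ∨ μ < lam) (n : ℕ) :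
    P.real {ω | N (T ω) ω = n} =
      (-1) ^ n / (n ! : ℝ) * Real.exp (t * μ ^ α) * ∑' m, innerTerm α μ lam t n m := by
  rw [hN.measureReal_randomTime_eq hlam.le hT.measurable hNT, hT.integral_pow_mul_exp_neg hlam,
    (hasSum_innerTerm hα hμ hlam h n).tsum_eq]
  ring

end MixedPoisson

section Difference

variable {Ω : Type*} [MeasurableSpace Ω] {P : Measure Ω} [IsFiniteMeasure P] {X Y : Ω → ℕ}

theorem hasSum_measureReal_sub_eq_of_indepFun (hX : AEMeasurable X P) (hY : AEMeasurable Y P)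
    (hXY : IndepFun X Y P) (k : ℕ) :
    HasSum (fun n => P.real {ω | X ω = n + k} * P.real {ω | Y ω = n})
      (P.real {ω | (X ω : ℤ) - Y ω = k}) := by
  have hunion : {ω | (X ω : ℤ) - Y ω = k} = ⋃ n, X ⁻¹' {n + k} ∩ Y ⁻¹' {n} := by
    ext ω
    simp only [Set.mem_ofPred_eq, Set.mem_iUnion, Set.mem_inter_iff, Set.mem_preimage,
      Set.mem_singleton_iff]
    exact ⟨fun h => ⟨Y ω, by omega, rfl⟩, fun ⟨_, _, _⟩ => by omega⟩
  have hnull (n : ℕ) : NullMeasurableSet (X ⁻¹' {n + k} ∩ Y ⁻¹' {n}) P :=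
    (hX.nullMeasurable (measurableSet_singleton _)).inter
      (hY.nullMeasurable (measurableSet_singleton _))
  have hdisj : Pairwise (Function.onFun (AEDisjoint P) fun n => X ⁻¹' {n + k} ∩ Y ⁻¹' {n}) :=
    fun i j hij => (Set.disjoint_left.2 fun ω hi hj => hij (hi.2.symm.trans hj.2)).aedisjoint
  have hsum := hasSum_integral_iUnion_ae hnull hdisj (integrable_const (1 : ℝ)).integrableOn
  simp only [setIntegral_const, smul_eq_mul, mul_one, ← hunion] at hsum
  refine hsum.congr_fun fun n => ?_
  rw [measureReal_def, measureReal_def, measureReal_def, ← ENNReal.toReal_mul]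
  exact congrArg ENNReal.toReal (hXY.measure_inter_preimage_eq_mul _ _
    (measurableSet_singleton (n + k)) (measurableSet_singleton n)).symm

theorem hasSum_measureReal_sub_eq_of_alternating {a b : ℕ → ℝ} {u v : ℝ} (hX : AEMeasurable X P)
    (hY : AEMeasurable Y P) (hXY : IndepFun X Y P)
    (ha : ∀ n, P.real {ω | X ω = n} = (-1) ^ n / (n ! : ℝ) * Real.exp u * a n)
    (hb : ∀ n, P.real {ω | Y ω = n} = (-1) ^ n / (n ! : ℝ) * Real.exp v * b n) (k : ℕ) :
    HasSum (fun n => (-1) ^ k / ((n ! : ℝ) * ((n + k)! : ℝ)) * Real.exp (u + v) * a (n + k) * b n)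
      (P.real {ω | (X ω : ℤ) - Y ω = k}) := by
  refine (hasSum_measureReal_sub_eq_of_indepFun hX hY hXY k).congr_fun fun n => ?_
  have hsign : ((-1 : ℝ) ^ n) * (-1) ^ n = 1 := by rw [← mul_pow]; norm_num
  rw [ha, hb, pow_add, Real.exp_add]
  linear_combination (-(-1) ^ k / ((n ! : ℝ) * ((n + k)! : ℝ)) * Real.exp u * Real.exp v *
    a (n + k) * b n) * hsign

theorem hasSum_measureReal_sub_eq_neg_of_alternating {a b : ℕ → ℝ} {u v : ℝ}
    (hX : AEMeasurable X P) (hY : AEMeasurable Y P) (hXY : IndepFun X Y P)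
    (ha : ∀ n, P.real {ω | X ω = n} = (-1) ^ n / (n ! : ℝ) * Real.exp u * a n)
    (hb : ∀ n, P.real {ω | Y ω = n} = (-1) ^ n / (n ! : ℝ) * Real.exp v * b n) (k : ℕ) :
    HasSum (fun n => (-1) ^ k / ((n ! : ℝ) * ((n + k)! : ℝ)) * Real.exp (u + v) * a n * b (n + k))
      (P.real {ω | (X ω : ℤ) - Y ω = -k}) := by
  simp only [← neg_sub (Y _ : ℤ), neg_inj, add_comm u, mul_right_comm _ (a _)]
  exact hasSum_measureReal_sub_eq_of_alternating hY hX hXY.symm hb ha k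

end Difference

theorem mainTheorem6_general {Ω : Type*} [MeasurableSpace Ω] {P : Measure Ω}
    [IsProbabilityMeasure P] {α₁ α₂ μ₁ μ₂ lam₁ lam₂ : ℝ}
    (hα₁ : 0 < α₁ ∧ α₁ < 1) (hα₂ : 0 < α₂ ∧ α₂ < 1)
    (hμ₁ : 0 ≤ μ₁) (hμ₂ : 0 ≤ μ₂) (hlam₁ : 0 < lam₁) (hlam₂ : 0 < lam₂)
    {N₁ N₂ : ℝ≥0 → Ω → ℕ} {T₁ T₂ : Ω → ℝ≥0} {t : ℝ≥0}
    (hN₁ : HasPoissonMarginals lam₁ N₁ P) (hN₂ : HasPoissonMarginals lam₂ N₂ P)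
    (hT₁ : HasTemperedStableLaw α₁ μ₁ t T₁ P) (hT₂ : HasTemperedStableLaw α₂ μ₂ t T₂ P)
    (hN : IndepFun (fun ω t => N₁ t ω) (fun ω t => N₂ t ω) P) (hT : IndepFun T₁ T₂ P)
    (hNT : IndepFun (fun ω => ((fun t => N₁ t ω), (fun t => N₂ t ω)))
      (fun ω => (T₁ ω, T₂ ω)) P) :
    (∀ j m : ℕ,
      Summable (foxWrightTerm 1 α₁ (1 - (j : ℝ) - (m : ℝ)) α₁ (-lam₁ ^ α₁ * t)) ∧
      Summable (foxWrightTerm 1 α₂ (1 - (j : ℝ) - (m : ℝ)) α₂ (-lam₂ ^ α₂ * t))) ∧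
    (∀ j : ℕ, 2 ≤ j →
      ((∃ s, Tendsto (fun M => ∑ m ∈ Finset.range M, innerTerm α₁ μ₁ lam₁ t j m) atTop (𝓝 s)) ↔
        t = 0 ∨ μ₁ < lam₁) ∧
      ((∃ s, Tendsto (fun M => ∑ l ∈ Finset.range M, innerTerm α₂ μ₂ lam₂ t j l) atTop (𝓝 s)) ↔
        t = 0 ∨ μ₂ < lam₂)) ∧
    (t = 0 ∨ (μ₁ < lam₁ ∧ μ₂ < lam₂) →
      (∀ j : ℕ, Summable (innerTerm α₁ μ₁ lam₁ t j) ∧ Summable (innerTerm α₂ μ₂ lam₂ t j)) ∧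
      ∀ k : ℤ,
        (0 ≤ k →
          HasSum
            (fun n : ℕ =>
              (-1 : ℝ) ^ k.natAbs / ((n ! : ℝ) * ((n + k.natAbs)! : ℝ)) *
                Real.exp (t * (μ₁ ^ α₁ + μ₂ ^ α₂)) *
                (∑' m : ℕ, innerTerm α₁ μ₁ lam₁ t (n + k.natAbs) m) *
                (∑' l : ℕ, innerTerm α₂ μ₂ lam₂ t n l))
            (P.real {ω | (N₁ (T₁ ω) ω : ℤ) - N₂ (T₂ ω) ω = k})) ∧
        (k < 0 →
          HasSum
            (fun n : ℕ =>
              (-1 : ℝ) ^ k.natAbs / ((n ! : ℝ) * ((n + k.natAbs)! : ℝ)) *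
                Real.exp (t * (μ₁ ^ α₁ + μ₂ ^ α₂)) *
                (∑' m : ℕ, innerTerm α₁ μ₁ lam₁ t n m) *
                (∑' l : ℕ, innerTerm α₂ μ₂ lam₂ t (n + k.natAbs) l))
            (P.real {ω | (N₁ (T₁ ω) ω : ℤ) - N₂ (T₂ ω) ω = k}))) := by
  refine ⟨fun j m => ⟨(hasSum_foxWrightTerm hα₁.1.le t j m hlam₁).summable,
      (hasSum_foxWrightTerm hα₂.1.le t j m hlam₂).summable⟩, fun j hj => ?_, fun h => ?_⟩
  · simp only [← NNReal.coe_eq_zero]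
    exact ⟨exists_tendsto_sum_innerTerm_iff hα₁.1 hα₁.2 hμ₁ hlam₁ t.2 hj,
      exists_tendsto_sum_innerTerm_iff hα₂.1 hα₂.2 hμ₂ hlam₂ t.2 hj⟩
  have h₁ : (t : ℝ) = 0 ∨ μ₁ < lam₁ := h.imp NNReal.coe_eq_zero.2 And.left
  have h₂ : (t : ℝ) = 0 ∨ μ₂ < lam₂ := h.imp NNReal.coe_eq_zero.2 And.right
  have hX₁ := hN₁.aemeasurable_randomTime hT₁.measurable
  have hX₂ := hN₂.aemeasurable_randomTime hT₂.measurable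
  have hX := hN₁.indepFun_randomTime hN₂ hT₁.measurable hT₂.measurable hN hT hNT
  have hpmf₁ := measureReal_randomTime_eq_tsum_innerTerm hα₁.1.le hμ₁ hlam₁ hN₁ hT₁
    (hNT.comp measurable_fst measurable_fst) h₁
  have hpmf₂ := measureReal_randomTime_eq_tsum_innerTerm hα₂.1.le hμ₂ hlam₂ hN₂ hT₂
    (hNT.comp measurable_snd measurable_snd) h₂
  refine ⟨fun j => ⟨(hasSum_innerTerm hα₁.1.le hμ₁ hlam₁ h₁ j).summable,
    (hasSum_innerTerm hα₂.1.le hμ₂ hlam₂ h₂ j).summable⟩, fun k => ⟨fun hk => ?_, fun hk => ?_⟩⟩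
  · lift k to ℕ using hk
    simpa only [mul_add, Int.natAbs_natCast] using
      hasSum_measureReal_sub_eq_of_alternating hX₁ hX₂ hX hpmf₁ hpmf₂ k
  · obtain ⟨k, rfl⟩ := Int.exists_eq_neg_ofNat hk.le
    simpa only [mul_add, Int.natAbs_neg, Int.natAbs_natCast] using
      hasSum_measureReal_sub_eq_neg_of_alternating hX₁ hX₂ hX hpmf₁ hpmf₂ k

theorem mainTheorem6 {Ω : Type*} [MeasurableSpace Ω] (P : Measure Ω) [IsProbabilityMeasure P]
    (α₁ α₂ μ₁ μ₂ lam₁ lam₂ : ℝ)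
    (hα₁ : 0 < α₁ ∧ α₁ < 1) (hα₂ : 0 < α₂ ∧ α₂ < 1)
    (hμ₁ : 0 < μ₁) (hμ₂ : 0 < μ₂) (hlam₁ : 0 < lam₁) (hlam₂ : 0 < lam₂)
    (N₁ N₂ : ℝ≥0 → Ω → ℕ) (D₁ D₂ : ℝ≥0 → Ω → ℝ≥0)
    (hN₁ : IsPoissonProcess lam₁ N₁ P) (hN₂ : IsPoissonProcess lam₂ N₂ P)
    (hD₁ : IsTemperedStableSubordinator α₁ μ₁ D₁ P)
    (hD₂ : IsTemperedStableSubordinator α₂ μ₂ D₂ P)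
    (hN : IndepFun (fun ω t => N₁ t ω) (fun ω t => N₂ t ω) P)
    (hD : IndepFun (fun ω t => D₁ t ω) (fun ω t => D₂ t ω) P)
    (hND : IndepFun (fun ω => ((fun t => N₁ t ω), (fun t => N₂ t ω)))
      (fun ω => ((fun t => D₁ t ω), (fun t => D₂ t ω))) P)
    (t : ℝ≥0) :
    -- the Fox–Wright series converge absolutely
    (∀ j m : ℕ,
      Summable (foxWrightTerm 1 α₁ (1 - (j : ℝ) - (m : ℝ)) α₁ (-lam₁ ^ α₁ * t)) ∧
      Summable (foxWrightTerm 1 α₂ (1 - (j : ℝ) - (m : ℝ)) α₂ (-lam₂ ^ α₂ * t))) ∧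
    -- the range of parameters in which the inner series converge
    (∀ j : ℕ, 2 ≤ j →
      ((∃ s, Tendsto (fun M => ∑ m ∈ Finset.range M, innerTerm α₁ μ₁ lam₁ t j m) atTop (𝓝 s)) ↔
        t = 0 ∨ μ₁ < lam₁) ∧
      ((∃ s, Tendsto (fun M => ∑ l ∈ Finset.range M, innerTerm α₂ μ₂ lam₂ t j l) atTop (𝓝 s)) ↔
        t = 0 ∨ μ₂ < lam₂)) ∧
    -- in that range the inner series converge absolutely and the formulas hold
    (t = 0 ∨ (μ₁ < lam₁ ∧ μ₂ < lam₂) →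
      (∀ j : ℕ, Summable (innerTerm α₁ μ₁ lam₁ t j) ∧ Summable (innerTerm α₂ μ₂ lam₂ t j)) ∧
      ∀ k : ℤ,
        (0 ≤ k →
          HasSum
            (fun n : ℕ =>
              (-1 : ℝ) ^ k.natAbs / ((n ! : ℝ) * ((n + k.natAbs)! : ℝ)) *
                Real.exp (t * (μ₁ ^ α₁ + μ₂ ^ α₂)) *
                (∑' m : ℕ, innerTerm α₁ μ₁ lam₁ t (n + k.natAbs) m) *
                (∑' l : ℕ, innerTerm α₂ μ₂ lam₂ t n l))
            (P.real {ω | tsfsp N₁ N₂ D₁ D₂ t ω = k})) ∧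
        (k < 0 →
          HasSum
            (fun n : ℕ =>
              (-1 : ℝ) ^ k.natAbs / ((n ! : ℝ) * ((n + k.natAbs)! : ℝ)) *
                Real.exp (t * (μ₁ ^ α₁ + μ₂ ^ α₂)) *
                (∑' m : ℕ, innerTerm α₁ μ₁ lam₁ t n m) *
                (∑' l : ℕ, innerTerm α₂ μ₂ lam₂ t (n + k.natAbs) l))
            (P.real {ω | tsfsp N₁ N₂ D₁ D₂ t ω = k}))) :=
  mainTheorem6_general hα₁ hα₂ hμ₁.le hμ₂.le hlam₁ hlam₂ hN₁.hasPoissonMarginals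
    hN₂.hasPoissonMarginals (hD₁.hasTemperedStableLaw t) (hD₂.hasTemperedStableLaw t) hN
    (hD.comp (measurable_pi_apply t) (measurable_pi_apply t))
    (hND.comp measurable_id ((measurable_pi_apply t).prodMap (measurable_pi_apply t)))
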